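/- Let $\lambda_1,\lambda_2\in\mathbb C$ with $|\lambda_1|,|\lambda_2|<1$, and let \[ A=\begin{bmatrix}0 & \sqrt{1-|\lambda_1|^2} & -\overline{\lambda_1}\sqrt{1-|\lambda_2|^2}\\ 0 & \lambda_1 & \sqrt{1-|\lambda_1|^2}\sqrt{1-|\lambda_2|^2}\\ 0 & 0 & \lambda_2\end{bmatrix}, \] a partial isometry of rank two with eigenvalues $0,\lambda_1,\lambda_2$. Let $W(A)=\{\langle Ax,x\rangle : x\in\mathbb C^3,\ \|x\|=1\}$ be its numerical range. Then: (i) if $\lambda_1=-\lambda_2$, then $W(A)$ is a (non-degenerate, closed) elliptical disk with foci $\lambda_1,\lambda_2$; (ii) if $\lambda_1=\lambda_2$, then $W(A)$ is a (non-degenerate, closed) elliptical disk with foci $0$ and $\lambda_1$; (iii) if $\lambda_1\neq\pm\lambda_2$, then $W(A)$ has an ovular shape, that is, it is a compact convex set with non-empty interior, its boundary is smooth (there is exactly one supporting line at each boundary point) and contains no non-degenerate line segment, and it is not an elliptical disk (for any choice of foci). (An elliptical disk with coinciding foci is a circular disk.) -/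

import Mathlib

open scoped ComplexConjugate

/-- The numerical range `W(A) = {⟨Ax, x⟩ : ‖x‖ = 1}` of a complex matrix
(Mathlib's inner product is conjugate-linear in its first argument). -/
def numericalRange {n : ℕ} (A : Matrix (Fin n) (Fin n) ℂ) : Set ℂ :=
  {w : ℂ | ∃ x : EuclideanSpace ℂ (Fin n), ‖x‖ = 1 ∧ w = inner ℂ x (Matrix.toEuclideanLin A x)}

/-- The 3-by-3 rank-two partial isometry in upper triangular form
with eigenvalues `0, μ₁, μ₂` in the open unit disk. -/
noncomputable def rankTwoPartialIsometry (μ₁ μ₂ : ℂ) : Matrix (Fin 3) (Fin 3) ℂ :=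
  !![0, (√(1 - ‖μ₁‖ ^ 2) : ℝ), -conj μ₁ * (√(1 - ‖μ₂‖ ^ 2) : ℝ);
     0, μ₁, (√(1 - ‖μ₁‖ ^ 2) : ℝ) * (√(1 - ‖μ₂‖ ^ 2) : ℝ);
     0, 0, μ₂]

/-- `K` is a (closed, non-degenerate) elliptical disk with foci `f₁` and `f₂`;
it is a circular disk when `f₁ = f₂`. -/
def IsEllipticalDisk (K : Set ℂ) (f₁ f₂ : ℂ) : Prop :=
  ∃ r : ℝ, dist f₁ f₂ < r ∧ K = {z : ℂ | dist z f₁ + dist z f₂ ≤ r}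

/-- The boundary of `K` contains a flat portion, that is, a non-degenerate line segment. -/
def HasFlatPortion (K : Set ℂ) : Prop :=
  ∃ p q : ℂ, p ≠ q ∧ segment ℝ p q ⊆ frontier K

/-- The boundary of `K` has no corners: through each boundary point there is exactly one
supporting line (recorded by its outer unit normal `u`). -/
def HasSmoothBoundary (K : Set ℂ) : Prop :=
  ∀ p ∈ frontier K, ∃! u : ℂ, ‖u‖ = 1 ∧ ∀ z ∈ K, inner ℝ u z ≤ inner ℝ u p

/-- `K` is of ovular shape: a planar convex body whose boundary is smooth and has no flat
portions, and which is not an elliptical disk. -/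
structure IsOvular (K : Set ℂ) : Prop where
  isCompact : IsCompact K
  convex : Convex ℝ K
  nonempty_interior : (interior K).Nonempty
  smooth : HasSmoothBoundary K
  not_flat : ¬ HasFlatPortion K
  not_elliptical : ∀ f₁ f₂ : ℂ, ¬ IsEllipticalDisk K f₁ f₂

/-! A compact convex planar set is determined by its support function. For `W(A)` in a unit
direction `u` this is the largest eigenvalue of the Hermitian part of `ū A`, hence the largest root
of a real cubic (`supportCubic`) whose coefficients involve only `α = Re(ū μ₁)`, `β = Re(ū μ₂)` and
the two moduli. When `μ₁ = ±μ₂` the cubic splits into a linear factor and a quadratic. The larger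
root of the quadratic dominates the linear root and has the form `⟨u,c⟩ + √(⟨u,d⟩² + a² - |d|²)`,
the support function of an ellipse. Conversely, if `W(A)` is an ellipse, replacing `u` by `-u` shows
that both signs of the square root give roots. The third root is then a linear form `⟨u,L⟩`.
Substituting it equates a product of three linear forms on the circle with one linear form;
comparing third harmonics gives `L(L - μ₁)(L - μ₂) = 0`, and each factor leads back to `μ₁ = ±μ₂`.
The boundary is governed by `eq_zero_of_supportPencil_mulVec_eq_zero`: each eigenspace of the
Hermitian part is a line, which excludes flat portions. At a corner, a single vector would be an
eigenvector for two directions, and the matrix entries forbid this. -/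

/-! ### Supporting lines of planar convex sets -/

theorem Complex.real_inner_eq (u z : ℂ) : inner ℝ u z = u.re * z.re + u.im * z.im := by
  simp [Complex.inner, Complex.mul_re, mul_comm]

theorem Complex.norm_sq_eq_re_im (z : ℂ) : ‖z‖ ^ 2 = z.re ^ 2 + z.im ^ 2 := by
  rw [Complex.sq_norm, Complex.normSq_apply]; ring

/-- Strict separation of a point from a closed convex set by a unit normal. -/
theorem exists_unit_normal_of_notMem {K : Set ℂ} (hK : IsClosed K) (hc : Convex ℝ K)
    (hne : K.Nonempty) {p : ℂ} (hp : p ∉ K) :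
    ∃ u : ℂ, ‖u‖ = 1 ∧ ∀ z ∈ K, inner ℝ u z < inner ℝ u p := by
  obtain ⟨f, s, hs, hsp⟩ := geometric_hahn_banach_closed_point hc hK hp
  obtain ⟨v, rfl⟩ := (InnerProductSpace.toDual ℝ ℂ).surjective f
  simp only [InnerProductSpace.toDual_apply_apply] at hs hsp
  obtain ⟨k, hk⟩ := hne
  have hv : v ≠ 0 := by
    rintro rfl
    have := hs k hk
    simp only [inner_zero_left] at this hsp
    linarith
  refine ⟨‖v‖⁻¹ • v, norm_smul_inv_norm (𝕜 := ℝ) hv, fun z hz => ?_⟩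
  simp only [real_inner_smul_left]
  exact mul_lt_mul_of_pos_left ((hs z hz).trans hsp) (by positivity)

/-- A closed convex planar set has a supporting line at each frontier point. -/
theorem exists_supporting_normal {K : Set ℂ} (hK : IsClosed K) (hc : Convex ℝ K)
    {p : ℂ} (hp : p ∈ frontier K) :
    ∃ u : ℂ, ‖u‖ = 1 ∧ ∀ z ∈ K, inner ℝ u z ≤ inner ℝ u p := by
  have hne : K.Nonempty := ⟨p, hK.frontier_subset hp⟩
  rw [frontier_eq_closure_inter_closure] at hp
  obtain ⟨x, hx, hxp⟩ := mem_closure_iff_seq_limit.1 hp.2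
  -- Strictly separating normals at exterior points tending to `p`; a limit of a subsequence, taken
  -- on the compact unit circle, supports at `p`.
  choose u hu hsep using fun n => exists_unit_normal_of_notMem hK hc hne (hx n)
  obtain ⟨v, hv, φ, hφ, hlim⟩ := (isCompact_sphere (0 : ℂ) 1).tendsto_subseq
    (x := u) (fun n => by simp [hu n])
  refine ⟨v, by simpa using hv, fun z hz => ?_⟩
  exact le_of_tendsto_of_tendsto' (hlim.inner tendsto_const_nhds)
    (hlim.inner (hxp.comp hφ.tendsto_atTop)) fun n => (hsep _ z hz).le

/-- A set whose support function is dominated by that of a closed convex set lies in it. -/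
theorem subset_of_support_le {K S : Set ℂ} (hK : IsClosed K) (hc : Convex ℝ K)
    (hne : K.Nonempty)
    (h : ∀ u : ℂ, ‖u‖ = 1 → ∀ z ∈ S, ∃ k ∈ K, inner ℝ u z ≤ inner ℝ u k) : S ⊆ K := by
  intro z hz
  by_contra hzK
  obtain ⟨u, hu, hsep⟩ := exists_unit_normal_of_notMem hK hc hne hzK
  obtain ⟨k, hk, hle⟩ := h u hu z hz
  exact absurd (hsep k hk) hle.not_gt

/-! ### Elliptical disks and their support functions -/

theorem isClosed_setOf_dist_add_dist_le (f₁ f₂ : ℂ) (r : ℝ) :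
    IsClosed {z : ℂ | dist z f₁ + dist z f₂ ≤ r} :=
  isClosed_le (by fun_prop) continuous_const

theorem convex_setOf_dist_add_dist_le (f₁ f₂ : ℂ) (r : ℝ) :
    Convex ℝ {z : ℂ | dist z f₁ + dist z f₂ ≤ r} := by
  have h := ((convexOn_univ_dist f₁).add (convexOn_univ_dist f₂)).convex_le r
  simpa using h

/-- The quadratic equation of an elliptical disk with center `c`, half focal vector `d`,
and major semi-axis `a`. -/
theorem dist_add_dist_le_iff {c d z : ℂ} {a : ℝ} (ha : ‖d‖ < a) :
    dist z (c + d) + dist z (c - d) ≤ 2 * a ↔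
      a ^ 2 * ‖z - c‖ ^ 2 - (inner ℝ (z - c) d) ^ 2 ≤ a ^ 2 * (a ^ 2 - ‖d‖ ^ 2) := by
  obtain ⟨w, rfl⟩ : ∃ w, z = c + w := ⟨z - c, by ring⟩
  have e1 : dist (c + w) (c + d) = ‖w - d‖ := by rw [dist_eq_norm]; congr 1; ring
  have e2 : dist (c + w) (c - d) = ‖w + d‖ := by rw [dist_eq_norm]; congr 1; ring
  rw [e1, e2, add_sub_cancel_left]
  have hX := norm_sub_sq_real w d
  have hY := norm_add_sq_real w d
  have hX0 := norm_nonneg (w - d)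
  have hY0 := norm_nonneg (w + d)
  have hd0 := norm_nonneg d
  have hdiff : |‖w + d‖ - ‖w - d‖| ≤ 2 * ‖d‖ := by
    refine (abs_norm_sub_norm_le _ _).trans ?_
    have : w + d - (w - d) = 2 * d := by ring
    rw [this]; simp
  rw [abs_le] at hdiff
  set X := ‖w - d‖
  set Y := ‖w + d‖
  have hpos : 0 < 4 * a ^ 2 - (Y - X) ^ 2 := by nlinarith
  -- Squaring away the radicals: `X² + Y²` and `Y² - X²` are polynomial in `w` and `d`. The second
  -- factor is positive because `|Y - X| ≤ 2‖d‖ < 2a`, so the first one carries the sign.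
  have hid : (4 * a ^ 2 - (X + Y) ^ 2) * (4 * a ^ 2 - (Y - X) ^ 2) =
      16 * (a ^ 2 * (a ^ 2 - ‖d‖ ^ 2) - (a ^ 2 * ‖w‖ ^ 2 - (inner ℝ w d) ^ 2)) := by
    have e : (4 * a ^ 2 - (X + Y) ^ 2) * (4 * a ^ 2 - (Y - X) ^ 2) =
      16 * a ^ 4 - 8 * a ^ 2 * (X ^ 2 + Y ^ 2) + (Y ^ 2 - X ^ 2) ^ 2 := by ring
    rw [e, hX, hY]; ring
  constructor
  · intro h
    have h1 : 0 ≤ 4 * a ^ 2 - (X + Y) ^ 2 := by nlinarith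
    nlinarith [mul_nonneg h1 hpos.le]
  · intro h
    have h1 : 0 ≤ 4 * a ^ 2 - (X + Y) ^ 2 := by
      by_contra hneg
      nlinarith [mul_neg_of_neg_of_pos (not_le.1 hneg) hpos]
    nlinarith

/-- The support function of an elliptical disk. -/
theorem isGreatest_inner_image_ellipticalDisk {c d u : ℂ} {a : ℝ} (ha : ‖d‖ < a) (hu : ‖u‖ = 1) :
    IsGreatest ((fun z : ℂ => inner ℝ u z) '' {z | dist z (c + d) + dist z (c - d) ≤ 2 * a})
      (inner ℝ u c + √((inner ℝ u d) ^ 2 + (a ^ 2 - ‖d‖ ^ 2))) := by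
  have hd0 := norm_nonneg d
  have hb : 0 < a ^ 2 - ‖d‖ ^ 2 := by nlinarith
  have hS : 0 < (inner ℝ u d) ^ 2 + (a ^ 2 - ‖d‖ ^ 2) := by positivity
  have hS2 := Real.sq_sqrt hS.le
  have hS0 := Real.sqrt_pos.2 hS
  have hu2 : u.re ^ 2 + u.im ^ 2 = 1 := by rw [← Complex.norm_sq_eq_re_im, hu]; norm_num
  have hdn := Complex.norm_sq_eq_re_im d
  generalize hB : a ^ 2 - ‖d‖ ^ 2 = B at *
  have hA : a ^ 2 = B + ‖d‖ ^ 2 := by linarith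
  have hA0 : 0 < a ^ 2 := by rw [hA]; positivity
  set S := √((inner ℝ u d) ^ 2 + B) with hSdef
  constructor
  -- The point of tangency, namely the gradient in `u` of the homogeneous support function `⟨u,c⟩ +
  -- √(⟨u,d⟩² + B|u|²)`.
  · refine ⟨c + (S⁻¹ : ℝ) • (((B : ℝ) : ℂ) * u + ((inner ℝ u d : ℝ) : ℂ) * d), ?_, ?_⟩
    · rw [Set.mem_ofPred_eq, dist_add_dist_le_iff ha, add_sub_cancel_left, norm_smul, mul_pow,
        real_inner_smul_left, mul_pow, hB]
      have e1 : a ^ 2 * ‖(B : ℂ) * u + ((inner ℝ u d : ℝ) : ℂ) * d‖ ^ 2 -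
          (inner ℝ ((B : ℂ) * u + ((inner ℝ u d : ℝ) : ℂ) * d) d) ^ 2 = S ^ 2 * (a ^ 2 * B) := by
        rw [hS2, hA, hdn, Complex.norm_sq_eq_re_im]
        simp only [Complex.real_inner_eq, Complex.add_re, Complex.add_im, Complex.mul_re,
          Complex.mul_im, Complex.ofReal_re, Complex.ofReal_im]
        have hui : u.im ^ 2 = 1 - u.re ^ 2 := by linarith
        grind
      have e2 : ‖S⁻¹‖ ^ 2 = (S⁻¹) ^ 2 := by simp
      rw [e2, show a ^ 2 * ((S⁻¹) ^ 2 * ‖(B : ℂ) * u + ((inner ℝ u d : ℝ) : ℂ) * d‖ ^ 2) -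
          (S⁻¹) ^ 2 * (inner ℝ ((B : ℂ) * u + ((inner ℝ u d : ℝ) : ℂ) * d) d) ^ 2 =
          (S⁻¹) ^ 2 * (a ^ 2 * ‖(B : ℂ) * u + ((inner ℝ u d : ℝ) : ℂ) * d‖ ^ 2 -
          (inner ℝ ((B : ℂ) * u + ((inner ℝ u d : ℝ) : ℂ) * d) d) ^ 2) by ring, e1]
      apply le_of_eq
      field_simp
    · have e1 : inner ℝ u ((B : ℂ) * u + ((inner ℝ u d : ℝ) : ℂ) * d) = S ^ 2 := by
        rw [hS2]
        simp only [Complex.real_inner_eq, Complex.add_re, Complex.add_im, Complex.mul_re,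
          Complex.mul_im, Complex.ofReal_re, Complex.ofReal_im]
        linear_combination B * hu2
      simp only [inner_add_right _ c, real_inner_smul_right]
      rw [e1]
      field_simp
  · rintro _ ⟨z, hz, rfl⟩
    rw [Set.mem_ofPred_eq, dist_add_dist_le_iff ha, hB] at hz
    obtain ⟨w, rfl⟩ : ∃ w, z = c + w := ⟨z - c, by ring⟩
    rw [add_sub_cancel_left] at hz
    simp only [inner_add_right]
    gcongr
    apply Real.le_sqrt_of_sq_le
    -- Cauchy–Schwarz for the quadratic form of the ellipse, with its defect as an explicit square:
    -- the cross product of `w` with the tangency direction `B u + ⟨u,d⟩ d`.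
    have key : ((inner ℝ u d) ^ 2 + B) * (a ^ 2 * ‖w‖ ^ 2 - (inner ℝ w d) ^ 2) -
        a ^ 2 * B * (inner ℝ u w) ^ 2 =
        (B * (u.re * w.im - u.im * w.re) + (inner ℝ u d) * (d.re * w.im - d.im * w.re)) ^ 2 := by
      rw [hA, hdn, Complex.norm_sq_eq_re_im w]
      simp only [Complex.real_inner_eq]
      have hui : u.im ^ 2 = 1 - u.re ^ 2 := by linarith
      grind
    have h1 := mul_le_mul_of_nonneg_left hz hS.le
    have h2 : a ^ 2 * B * (inner ℝ u w) ^ 2 ≤ a ^ 2 * B * ((inner ℝ u d) ^ 2 + B) := by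
      nlinarith [sq_nonneg (B * (u.re * w.im - u.im * w.re) +
        (inner ℝ u d) * (d.re * w.im - d.im * w.re))]
    exact le_of_mul_le_mul_left h2 (by positivity)

/-! ### Compactness and convexity of the numerical range -/

open Matrix in
theorem mem_numericalRange_iff {n : ℕ} {A : Matrix (Fin n) (Fin n) ℂ} {w : ℂ} :
    w ∈ numericalRange A ↔ ∃ x : Fin n → ℂ, star x ⬝ᵥ x = 1 ∧ w = star x ⬝ᵥ (A *ᵥ x) := by
  have hn (x : EuclideanSpace ℂ (Fin n)) : ‖x‖ = 1 ↔ star x.ofLp ⬝ᵥ x.ofLp = 1 := by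
    have h := inner_self_eq_norm_sq_to_K (𝕜 := ℂ) x
    rw [EuclideanSpace.inner_eq_star_dotProduct, dotProduct_comm] at h
    rw [h]
    constructor
    · intro h; simp [h]
    · intro h
      have h' : ‖x‖ ^ 2 = 1 := by
        have := congrArg Complex.re h
        simpa [← Complex.ofReal_pow] using this
      nlinarith [norm_nonneg x]
  constructor
  · rintro ⟨x, hx, rfl⟩
    refine ⟨x.ofLp, (hn x).1 hx, ?_⟩
    rw [EuclideanSpace.inner_eq_star_dotProduct, dotProduct_comm]
    simp
  · rintro ⟨x, hx, rfl⟩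
    refine ⟨WithLp.toLp 2 x, (hn _).2 hx, ?_⟩
    rw [EuclideanSpace.inner_eq_star_dotProduct, dotProduct_comm]
    simp

theorem isCompact_numericalRange {n : ℕ} (A : Matrix (Fin n) (Fin n) ℂ) :
    IsCompact (numericalRange A) := by
  have h : numericalRange A = (fun x : EuclideanSpace ℂ (Fin n) =>
      inner ℂ x (Matrix.toEuclideanLin A x)) '' Metric.sphere 0 1 := by
    ext w
    simp [numericalRange, eq_comm]
  rw [h]
  refine (isCompact_sphere _ _).image ?_
  have := (Matrix.toEuclideanLin A).continuous_of_finiteDimensional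
  fun_prop

theorem numericalRange_nonempty {n : ℕ} (A : Matrix (Fin (n + 1)) (Fin (n + 1)) ℂ) :
    (numericalRange A).Nonempty :=
  ⟨_, EuclideanSpace.single 0 1, by simp, rfl⟩

/-- The normalized case of the **Toeplitz–Hausdorff theorem**. -/
theorem exists_unit_inner_eq {E : Type*} [NormedAddCommGroup E] [InnerProductSpace ℂ E]
    (T : E →ₗ[ℂ] E) {x y : E} (hx : ‖x‖ = 1) (hy : ‖y‖ = 1)
    (hTx : inner ℂ x (T x) = 0) (hTy : inner ℂ y (T y) = 1) {t : ℝ} (ht : t ∈ Set.Icc (0 : ℝ) 1) :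
    ∃ z : E, ‖z‖ = 1 ∧ inner ℂ z (T z) = t := by
  -- Rotating `x` by a phase makes the cross terms real, so the quadratic form is real along the
  -- segment `v` from `c • x` to `y`, and the intermediate value theorem applies to its Rayleigh
  -- quotient.
  obtain ⟨c, hc, hcr⟩ : ∃ c : ℂ, ‖c‖ = 1 ∧
      (conj c * inner ℂ x (T y) + c * inner ℂ y (T x)).im = 0 := by
    set p := inner ℂ x (T y)
    set q := inner ℂ y (T x)
    by_cases h : conj q - p = 0
    · refine ⟨1, by simp, ?_⟩
      have : p = conj q := by linear_combination -h
      simp [this]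
    · refine ⟨((‖conj q - p‖⁻¹ : ℝ) : ℂ) * (conj q - p), ?_, ?_⟩
      · rw [norm_mul, Complex.norm_real, norm_inv, norm_norm, inv_mul_cancel₀ (norm_ne_zero_iff.2 h)]
      · simp only [map_mul, Complex.conj_ofReal, mul_assoc, ← mul_add, Complex.im_ofReal_mul]
        simp
        right
        ring
  set g : ℝ := (conj c * inner ℂ x (T y) + c * inner ℂ y (T x)).re
  have hg : conj c * inner ℂ x (T y) + c * inner ℂ y (T x) = (g : ℂ) :=
    Complex.ext rfl (by simpa using hcr)
  set v : ℝ → E := fun s => ((1 - s : ℝ) : ℂ) • (c • x) + ((s : ℝ) : ℂ) • y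
  have hcc : conj c * c = 1 := by rw [Complex.conj_mul', hc]; norm_num
  have hq (s : ℝ) : inner ℂ (v s) (T (v s)) = ((s ^ 2 + (1 - s) * s * g : ℝ) : ℂ) := by
    simp only [v, map_add, map_smul, inner_add_left, inner_add_right, inner_smul_left,
      inner_smul_right, hTx, hTy, Complex.conj_ofReal]
    push_cast
    rw [← hg]
    ring
  -- If `v s` vanished, `y` would be a multiple of `x`, forcing `⟨y, T y⟩ = 0` instead of `1`.
  have hv (s : ℝ) : v s ≠ 0 := by
    intro h0
    by_cases hs : (s : ℂ) = 0
    · have h1 : s = 0 := by exact_mod_cast hs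
      simp only [v, h1] at h0
      simp at h0
      rcases h0 with h0 | h0
      · simp [h0] at hc
      · simp [h0] at hx
    · have : y = (-(s : ℂ)⁻¹ * ((1 - s : ℝ) : ℂ) * c) • x := by
        have h2 : (s : ℂ) • y = -(((1 - s : ℝ) : ℂ) • (c • x)) :=
          eq_neg_of_add_eq_zero_right h0
        rw [mul_assoc, mul_smul, mul_smul, neg_smul, ← smul_neg, ← h2, smul_smul,
          inv_mul_cancel₀ hs, one_smul]
      rw [this] at hTy
      simp [inner_smul_left, inner_smul_right, hTx] at hTy
  have hvc : Continuous v := by fun_prop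
  have hf : Continuous fun s => (s ^ 2 + (1 - s) * s * g) / ‖v s‖ ^ 2 :=
    (by fun_prop : Continuous fun s : ℝ => s ^ 2 + (1 - s) * s * g).div₀ (by fun_prop)
      fun s => by simpa using hv s
  have hivt := intermediate_value_Icc (zero_le_one' ℝ) hf.continuousOn
  have h0 : ((0:ℝ) ^ 2 + (1 - 0) * 0 * g) / ‖v 0‖ ^ 2 = 0 := by simp
  have h1 : ((1:ℝ) ^ 2 + (1 - 1) * 1 * g) / ‖v 1‖ ^ 2 = 1 := by simp [v, hy]
  rw [h0, h1] at hivt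
  obtain ⟨s, -, hs⟩ := hivt ht
  refine ⟨((‖v s‖⁻¹ : ℝ) : ℂ) • v s, ?_, ?_⟩
  · rw [norm_smul, Complex.norm_real, norm_inv, norm_norm, inv_mul_cancel₀ (norm_ne_zero_iff.2 (hv s))]
  · simp only [map_smul, inner_smul_left, inner_smul_right, hq, Complex.conj_ofReal]
    norm_cast
    simp only at hs
    rw [← hs]
    field_simp

/-- The **Toeplitz–Hausdorff theorem** for matrices. -/
theorem convex_numericalRange {n : ℕ} (A : Matrix (Fin n) (Fin n) ℂ) :
    Convex ℝ (numericalRange A) := by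
  rintro _ ⟨x, hx, rfl⟩ _ ⟨y, hy, rfl⟩ a b ha hb hab
  set T := Matrix.toEuclideanLin A
  set p := inner ℂ x (T x) with hp
  set q := inner ℂ y (T y) with hq
  by_cases hpq : q - p = 0
  · have : q = p := by linear_combination hpq
    rw [this, ← add_smul, hab, one_smul]
    exact ⟨x, hx, hp⟩
  -- The affine change of operator sending the values `p`, `q` to `0`, `1`.
  set B := (q - p)⁻¹ • (T - p • LinearMap.id)
  have hB (z : EuclideanSpace ℂ (Fin n)) (hz : ‖z‖ = 1) :
      inner ℂ z (B z) = (q - p)⁻¹ * (inner ℂ z (T z) - p) := by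
    simp [B, inner_self_eq_norm_sq_to_K, hz]
  obtain ⟨z, hz, hzb⟩ := exists_unit_inner_eq B hx hy (by rw [hB x hx, ← hp]; simp)
    (by rw [hB y hy, ← hq, inv_mul_cancel₀ hpq]) (t := b) ⟨hb, by linarith⟩
  refine ⟨z, hz, ?_⟩
  rw [hB z hz] at hzb
  have h2 : inner ℂ z (T z) = p + b * (q - p) := by
    field_simp at hzb
    linear_combination hzb
  change _ = inner ℂ z (T z)
  rw [h2]
  have : (a : ℂ) = 1 - b := by
    rw [← Complex.ofReal_one, ← hab]; push_cast; ring
  simp only [Complex.real_smul, this]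
  ring

/-! ### Support values as roots of a Hermitian pencil -/

open Matrix in
/-- The Hermitian matrix `2t - (ū A + u Aᴴ)`, which is positive semidefinite exactly when the
half-plane `Re (ū z) ≤ t` contains the numerical range of `A`. -/
noncomputable def supportPencil {n : ℕ} (A : Matrix (Fin n) (Fin n) ℂ) (u : ℂ) (t : ℝ) :
    Matrix (Fin n) (Fin n) ℂ :=
  (2 * t : ℂ) • 1 - (conj u • A + u • Aᴴ)

open Matrix in
theorem isHermitian_supportPencil {n : ℕ} (A : Matrix (Fin n) (Fin n) ℂ) (u : ℂ) (t : ℝ) :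
    (supportPencil A u t).IsHermitian := by
  ext i j
  simp [supportPencil, Matrix.one_apply, eq_comm, add_comm, apply_ite]

open Matrix in
theorem star_dotProduct_supportPencil_mulVec {n : ℕ} (A : Matrix (Fin n) (Fin n) ℂ) (u : ℂ) (t : ℝ)
    (x : Fin n → ℂ) : star x ⬝ᵥ (supportPencil A u t *ᵥ x) =
      2 * (t * (star x ⬝ᵥ x) - (inner ℝ u (star x ⬝ᵥ (A *ᵥ x)) : ℝ)) := by
  have h : star x ⬝ᵥ (Aᴴ *ᵥ x) = conj (star x ⬝ᵥ (A *ᵥ x)) := by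
    rw [starRingEnd_apply, star_dotProduct, star_mulVec, conjTranspose_conjTranspose,
      ← dotProduct_mulVec]
  have h2 (w : ℂ) : 2 * ((inner ℝ u w : ℝ) : ℂ) = conj u * w + u * conj w := by
    apply Complex.ext <;> simp [Complex.inner] <;> ring
  simp only [supportPencil, sub_mulVec, add_mulVec, smul_mulVec, one_mulVec, dotProduct_sub,
    dotProduct_add, dotProduct_smul, smul_eq_mul, h]
  rw [mul_sub, h2]
  ring

open Matrix in
theorem exists_unit_smul {n : ℕ} {x : Fin n → ℂ} (hx : x ≠ 0) :
    ∃ c : ℝ, 0 < c ∧ star x ⬝ᵥ x = ((c ^ 2 : ℝ) : ℂ) ∧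
      star (((c⁻¹ : ℝ) : ℂ) • x) ⬝ᵥ (((c⁻¹ : ℝ) : ℂ) • x) = 1 := by
  have h : star x ⬝ᵥ x = ((‖WithLp.toLp 2 x‖ ^ 2 : ℝ) : ℂ) := by
    have h := inner_self_eq_norm_sq_to_K (𝕜 := ℂ) (WithLp.toLp 2 x)
    rw [EuclideanSpace.inner_eq_star_dotProduct, dotProduct_comm] at h
    simpa using h
  have h0 : 0 < ‖WithLp.toLp 2 x‖ := by simpa using hx
  refine ⟨_, h0, h, ?_⟩
  rw [star_smul, smul_dotProduct, dotProduct_smul, h]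
  simp only [smul_eq_mul, RCLike.star_def, Complex.conj_ofReal]
  norm_cast
  field_simp

open Matrix ComplexOrder in
theorem posSemidef_supportPencil {n : ℕ} {A : Matrix (Fin n) (Fin n) ℂ} {u : ℂ} {t : ℝ}
    (h : ∀ z ∈ numericalRange A, inner ℝ u z ≤ t) : (supportPencil A u t).PosSemidef := by
  refine .of_dotProduct_mulVec_nonneg (isHermitian_supportPencil A u t) fun x => ?_
  by_cases hx : x = 0
  · simp [hx]
  obtain ⟨c, hc, hcx, hu⟩ := exists_unit_smul hx
  have h1 := h _ (mem_numericalRange_iff.2 ⟨_, hu, rfl⟩)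
  have h2 : star x ⬝ᵥ (supportPencil A u t *ᵥ x) = ((c ^ 2 : ℝ) : ℂ) *
      (star (((c⁻¹ : ℝ) : ℂ) • x) ⬝ᵥ (supportPencil A u t *ᵥ (((c⁻¹ : ℝ) : ℂ) • x))) := by
    rw [star_smul, smul_dotProduct, mulVec_smul, dotProduct_smul]
    simp only [smul_eq_mul, RCLike.star_def, Complex.conj_ofReal, ← mul_assoc]
    norm_cast
    field_simp
    simp
  rw [h2, star_dotProduct_supportPencil_mulVec, hu]
  norm_cast
  have : 0 ≤ t - inner ℝ u (star (((c⁻¹ : ℝ) : ℂ) • x) ⬝ᵥ (A *ᵥ (((c⁻¹ : ℝ) : ℂ) • x))) := by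
    linarith
  rw [mul_one]
  positivity

open Matrix in
/-- A unit vector at which the support value is attained lies in the kernel of the pencil. -/
theorem supportPencil_mulVec_eq_zero {n : ℕ} {A : Matrix (Fin n) (Fin n) ℂ} {u : ℂ} {t : ℝ}
    (h : ∀ z ∈ numericalRange A, inner ℝ u z ≤ t) {x : Fin n → ℂ} (hx : star x ⬝ᵥ x = 1)
    (hxt : inner ℝ u (star x ⬝ᵥ (A *ᵥ x)) = t) : supportPencil A u t *ᵥ x = 0 := by
  rw [← (posSemidef_supportPencil h).dotProduct_mulVec_zero_iff,
    star_dotProduct_supportPencil_mulVec, hx, hxt]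
  simp

open Matrix in
theorem ne_zero_of_star_dotProduct_self {n : ℕ} {x : Fin n → ℂ} (hx : star x ⬝ᵥ x = 1) :
    x ≠ 0 := by
  rintro rfl
  simp at hx

open Matrix in
theorem det_supportPencil_eq_zero {n : ℕ} {A : Matrix (Fin n) (Fin n) ℂ} {u : ℂ} {t : ℝ}
    (h : IsGreatest ((fun z => inner ℝ u z) '' numericalRange A) t) :
    (supportPencil A u t).det = 0 := by
  obtain ⟨⟨z, hz, hzt⟩, hub⟩ := h
  obtain ⟨x, hx, rfl⟩ := mem_numericalRange_iff.1 hz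
  exact exists_mulVec_eq_zero_iff.1 ⟨x, ne_zero_of_star_dotProduct_self hx,
    supportPencil_mulVec_eq_zero (fun z hz => hub ⟨z, hz, rfl⟩) hx hzt⟩

-- On a normalized kernel vector the quadratic form of the pencil vanishes. Every root `t`, not only
-- the largest, is thus attained as a value of `⟨u,·⟩` on `W(A)`.
open Matrix in
theorem exists_mem_numericalRange_inner_eq {n : ℕ} {A : Matrix (Fin n) (Fin n) ℂ} {u : ℂ} {t : ℝ}
    (h : (supportPencil A u t).det = 0) : ∃ z ∈ numericalRange A, inner ℝ u z = t := by
  obtain ⟨x, hx, hx0⟩ := exists_mulVec_eq_zero_iff.2 h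
  obtain ⟨c, -, -, hu⟩ := exists_unit_smul hx
  refine ⟨_, mem_numericalRange_iff.2 ⟨_, hu, rfl⟩, ?_⟩
  have h1 := star_dotProduct_supportPencil_mulVec A u t (((c⁻¹ : ℝ) : ℂ) • x)
  rw [mulVec_smul, hx0, hu, smul_zero, dotProduct_zero] at h1
  have h2 : (0 : ℝ) = 2 * (t * 1 - inner ℝ u (star (((c⁻¹ : ℝ) : ℂ) • x) ⬝ᵥ
    (A *ᵥ (((c⁻¹ : ℝ) : ℂ) • x)))) := by exact_mod_cast h1
  linarith

/-- The support function of the numerical range is the largest root of the pencil. -/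
theorem isGreatest_inner_image_numericalRange {n : ℕ} {A : Matrix (Fin (n + 1)) (Fin (n + 1)) ℂ}
    {u : ℂ} {t : ℝ} (h : IsGreatest {s : ℝ | (supportPencil A u s).det = 0} t) :
    IsGreatest ((fun z => inner ℝ u z) '' numericalRange A) t := by
  obtain ⟨s, hs⟩ := ((isCompact_numericalRange A).image
    (f := fun z => inner ℝ u z) (by fun_prop)).exists_isGreatest
    ((numericalRange_nonempty A).image _)
  obtain ⟨z, hz, hzt⟩ := exists_mem_numericalRange_inner_eq h.1
  have h1 : t ≤ s := hs.2 ⟨z, hz, hzt⟩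
  have h2 : s ≤ t := h.2 (det_supportPencil_eq_zero hs)
  rwa [le_antisymm h1 h2]

/-! ### The pencil and cubic of the partial isometry -/

open Matrix in
theorem supportPencil_rankTwoPartialIsometry_mulVec_eq_zero {μ₁ μ₂ u : ℂ} {t : ℝ} {x : Fin 3 → ℂ}
    (h : supportPencil (rankTwoPartialIsometry μ₁ μ₂) u t *ᵥ x = 0) :
    (2 * t * x 0 - conj u * √(1 - ‖μ₁‖ ^ 2) * x 1 + conj u * conj μ₁ * √(1 - ‖μ₂‖ ^ 2) * x 2 = 0) ∧
    (-(u * √(1 - ‖μ₁‖ ^ 2) * x 0) + (2 * t - (conj u * μ₁ + u * conj μ₁)) * x 1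
      - conj u * √(1 - ‖μ₁‖ ^ 2) * √(1 - ‖μ₂‖ ^ 2) * x 2 = 0) ∧
    (u * μ₁ * √(1 - ‖μ₂‖ ^ 2) * x 0 - u * √(1 - ‖μ₁‖ ^ 2) * √(1 - ‖μ₂‖ ^ 2) * x 1
      + (2 * t - (conj u * μ₂ + u * conj μ₂)) * x 2 = 0) := by
  have h0 := congrFun h 0
  have h1 := congrFun h 1
  have h2 := congrFun h 2
  simp [supportPencil, rankTwoPartialIsometry, mulVec, dotProduct, Fin.sum_univ_three,
    Matrix.one_apply] at h0 h1 h2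
  refine ⟨?_, ?_, ?_⟩
  · linear_combination h0
  · linear_combination h1
  · linear_combination h2

/-- The monic cubic whose roots are the eigenvalues of the Hermitian part of
`conj u • rankTwoPartialIsometry μ₁ μ₂`. -/
noncomputable def supportCubic (μ₁ μ₂ u : ℂ) (t : ℝ) : ℝ :=
  t * (t - inner ℝ u μ₁) * (t - inner ℝ u μ₂) -
    ((t - inner ℝ u μ₁) * (1 - ‖μ₂‖ ^ 2) + (t - inner ℝ u μ₂) * (1 - ‖μ₁‖ ^ 2)) / 4

theorem one_sub_norm_sq_pos {μ : ℂ} (h : ‖μ‖ < 1) : 0 < 1 - ‖μ‖ ^ 2 := by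
  nlinarith [norm_nonneg μ]

theorem ofReal_sqrt_one_sub_norm_sq_sq {μ : ℂ} (h : ‖μ‖ < 1) :
    ((√(1 - ‖μ‖ ^ 2) : ℝ) : ℂ) ^ 2 = 1 - μ * conj μ := by
  rw [← Complex.ofReal_pow, Real.sq_sqrt (one_sub_norm_sq_pos h).le, Complex.mul_conj']
  push_cast; ring

theorem ofReal_sqrt_one_sub_norm_sq_ne_zero {μ : ℂ} (h : ‖μ‖ < 1) :
    ((√(1 - ‖μ‖ ^ 2) : ℝ) : ℂ) ≠ 0 := by
  exact_mod_cast (Real.sqrt_pos.2 (one_sub_norm_sq_pos h)).ne'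

theorem conj_mul_self_of_norm_eq_one {u : ℂ} (hu : ‖u‖ = 1) : conj u * u = 1 := by
  rw [Complex.conj_mul', hu]; norm_num

theorem two_mul_ofReal_inner (u w : ℂ) :
    2 * ((inner ℝ u w : ℝ) : ℂ) = conj u * w + u * conj w := by
  apply Complex.ext <;> simp [Complex.inner] <;> ring

theorem det_supportPencil_rankTwoPartialIsometry {μ₁ μ₂ u : ℂ} (h₁ : ‖μ₁‖ < 1) (h₂ : ‖μ₂‖ < 1)
    (hu : ‖u‖ = 1) (t : ℝ) :
    (supportPencil (rankTwoPartialIsometry μ₁ μ₂) u t).det =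
      ((8 * supportCubic μ₁ μ₂ u t : ℝ) : ℂ) := by
  have e1 := ofReal_sqrt_one_sub_norm_sq_sq h₁
  have e2 := ofReal_sqrt_one_sub_norm_sq_sq h₂
  have eu := conj_mul_self_of_norm_eq_one hu
  have i1 := two_mul_ofReal_inner u μ₁
  have i2 := two_mul_ofReal_inner u μ₂
  rw [supportCubic]
  push_cast
  rw [← Complex.mul_conj', ← Complex.mul_conj']
  generalize ((inner ℝ u μ₁ : ℝ) : ℂ) = α at *
  generalize ((inner ℝ u μ₂ : ℝ) : ℂ) = β at *
  rw [Matrix.det_fin_three]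
  simp [supportPencil, rankTwoPartialIsometry]
  -- Conjugates and square roots become independent variables, tied only by `v u = 1`, `s² = 1 -
  -- μ₁ν₁` and `s'² = 1 - μ₂ν₂`; a polynomial identity modulo these relations remains.
  generalize ((√(1 - ‖μ₁‖ ^ 2) : ℝ) : ℂ) = s at *
  generalize ((√(1 - ‖μ₂‖ ^ 2) : ℝ) : ℂ) = s' at *
  generalize conj u = v at *
  generalize conj μ₁ = ν₁ at *
  generalize conj μ₂ = ν₂ at *
  obtain rfl : α = (v * μ₁ + u * ν₁) / 2 := by linear_combination i1 / 2
  obtain rfl : β = (v * μ₂ + u * ν₂) / 2 := by linear_combination i2 / 2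
  grind

theorem det_supportPencil_rankTwoPartialIsometry_eq_zero_iff {μ₁ μ₂ u : ℂ} (h₁ : ‖μ₁‖ < 1)
    (h₂ : ‖μ₂‖ < 1) (hu : ‖u‖ = 1) (t : ℝ) :
    (supportPencil (rankTwoPartialIsometry μ₁ μ₂) u t).det = 0 ↔ supportCubic μ₁ μ₂ u t = 0 := by
  rw [det_supportPencil_rankTwoPartialIsometry h₁ h₂ hu, Complex.ofReal_eq_zero]
  simp

/-! ### The elliptical cases -/

/-- A nonempty compact convex set with the support function of an elliptical disk is that disk. -/
theorem isEllipticalDisk_of_support {K : Set ℂ} (hK : IsCompact K) (hc : Convex ℝ K)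
    (hne : K.Nonempty) {c d : ℂ} {a : ℝ} (ha : ‖d‖ < a)
    (h : ∀ u : ℂ, ‖u‖ = 1 → IsGreatest ((fun z => inner ℝ u z) '' K)
      (inner ℝ u c + √((inner ℝ u d) ^ 2 + (a ^ 2 - ‖d‖ ^ 2)))) :
    IsEllipticalDisk K (c + d) (c - d) := by
  refine ⟨2 * a, ?_, ?_⟩
  · rw [dist_eq_norm, show c + d - (c - d) = 2 * d by ring]
    simpa using ha
  have hE := fun u hu => isGreatest_inner_image_ellipticalDisk (c := c) (u := u) ha hu
  apply Set.Subset.antisymm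
  · refine subset_of_support_le (isClosed_setOf_dist_add_dist_le _ _ _)
      (convex_setOf_dist_add_dist_le _ _ _) (hE 1 (by simp)).nonempty.of_image fun u hu z hz => ?_
    obtain ⟨k, hk, hku⟩ := (hE u hu).1
    exact ⟨k, hk, (h u hu).2 ⟨z, hz, rfl⟩ |>.trans_eq hku.symm⟩
  · refine subset_of_support_le hK.isClosed hc hne fun u hu z hz => ?_
    obtain ⟨k, hk, hku⟩ := (h u hu).1
    exact ⟨k, hk, (hE u hu).2 ⟨z, hz, rfl⟩ |>.trans_eq hku.symm⟩

theorem isEllipticalDisk_numericalRange_of_roots {μ₁ μ₂ : ℂ} (h₁ : ‖μ₁‖ < 1) (h₂ : ‖μ₂‖ < 1)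
    {c d : ℂ} {a : ℝ} (ha : ‖d‖ < a)
    (h : ∀ u : ℂ, ‖u‖ = 1 → IsGreatest {t : ℝ | supportCubic μ₁ μ₂ u t = 0}
      (inner ℝ u c + √((inner ℝ u d) ^ 2 + (a ^ 2 - ‖d‖ ^ 2)))) :
    IsEllipticalDisk (numericalRange (rankTwoPartialIsometry μ₁ μ₂)) (c + d) (c - d) := by
  refine isEllipticalDisk_of_support (isCompact_numericalRange _) (convex_numericalRange _)
    (numericalRange_nonempty _) ha fun u hu => isGreatest_inner_image_numericalRange ?_
  simpa only [det_supportPencil_rankTwoPartialIsometry_eq_zero_iff h₁ h₂ hu] using h u hu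

theorem isEllipticalDisk_numericalRange_neg {μ : ℂ} (h : ‖μ‖ < 1) :
    IsEllipticalDisk (numericalRange (rankTwoPartialIsometry (-μ) μ)) (-μ) μ := by
  have h0 := norm_nonneg μ
  have hsq : √((1 + ‖μ‖ ^ 2) / 2) ^ 2 = (1 + ‖μ‖ ^ 2) / 2 := Real.sq_sqrt (by positivity)
  have key := isEllipticalDisk_numericalRange_of_roots (μ₁ := -μ) (by simpa using h) h (c := 0)
    (d := -μ) (a := √((1 + ‖μ‖ ^ 2) / 2)) ?_ ?_
  · simpa using key
  · rw [norm_neg]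
    apply Real.lt_sqrt_of_sq_lt
    nlinarith
  · intro u hu
    rw [hsq, norm_neg]
    have hm := one_sub_norm_sq_pos h
    have hS : 0 < (inner ℝ u (-μ)) ^ 2 + ((1 + ‖μ‖ ^ 2) / 2 - ‖μ‖ ^ 2) := by
      have := sq_nonneg (inner ℝ u (-μ)); linarith
    have hS2 := Real.sq_sqrt hS.le
    have hS0 := Real.sqrt_pos.2 hS
    set S := √((inner ℝ u (-μ)) ^ 2 + ((1 + ‖μ‖ ^ 2) / 2 - ‖μ‖ ^ 2))
    -- Here `α = -β`, so the constant term vanishes and the cubic is `t(t² - α² - (1 - ‖μ‖²)/2)`.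
    -- Matching the last constant with `a² - ‖μ‖²` dictates `a² = (1 + ‖μ‖²)/2`.
    have hP (t : ℝ) : supportCubic (-μ) μ u t = t * ((t - S) * (t + S)) := by
      simp only [supportCubic, norm_neg, inner_neg_right] at hS2 ⊢
      linear_combination t * hS2
    simp only [hP, inner_zero_right, zero_add]
    constructor
    · simp
    · intro t ht
      rcases mul_eq_zero.1 ht with rfl | ht
      · exact hS0.le
      · rcases mul_eq_zero.1 ht with ht | ht <;> linarith

theorem isEllipticalDisk_numericalRange_self {μ : ℂ} (h : ‖μ‖ < 1) :
    IsEllipticalDisk (numericalRange (rankTwoPartialIsometry μ μ)) 0 μ := by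
  have h0 := norm_nonneg μ
  have hsq : √((2 - ‖μ‖ ^ 2) / 4) ^ 2 = (2 - ‖μ‖ ^ 2) / 4 := Real.sq_sqrt (by nlinarith)
  have hn : ‖-(μ / 2)‖ = ‖μ‖ / 2 := by simp
  have key := isEllipticalDisk_numericalRange_of_roots (μ₁ := μ) h h (c := μ / 2)
    (d := -(μ / 2)) (a := √((2 - ‖μ‖ ^ 2) / 4)) ?_ ?_
  · simpa using key
  · rw [hn]
    apply Real.lt_sqrt_of_sq_lt
    nlinarith
  · intro u hu
    rw [hsq, hn]
    have hm := one_sub_norm_sq_pos h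
    have hi : inner ℝ u (μ / 2) = inner ℝ u μ / 2 := by
      simp only [Complex.real_inner_eq, Complex.div_ofNat_re, Complex.div_ofNat_im]; ring
    have hT : (inner ℝ u (-(μ / 2))) ^ 2 = (inner ℝ u μ / 2) ^ 2 := by
      rw [inner_neg_right, hi, neg_sq]
    rw [hT, hi]
    have hlt : (inner ℝ u μ / 2) ^ 2 ≤
      (inner ℝ u μ / 2) ^ 2 + ((2 - ‖μ‖ ^ 2) / 4 - (‖μ‖ / 2) ^ 2) := by nlinarith
    have hS2 := Real.sq_sqrt ((sq_nonneg _).trans hlt)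
    have hS0 := Real.abs_le_sqrt hlt
    rw [abs_le] at hS0
    set S := √((inner ℝ u μ / 2) ^ 2 + ((2 - ‖μ‖ ^ 2) / 4 - (‖μ‖ / 2) ^ 2))
    -- With `α = β` the factor `t - α` splits off. Its root does not exceed `α/2 + S` because `S ≥
    -- |α/2|`.
    have hP (t : ℝ) : supportCubic μ μ u t = (t - inner ℝ u μ) *
        ((t - (inner ℝ u μ / 2 + S)) * (t - (inner ℝ u μ / 2 - S))) := by
      simp only [supportCubic]
      linear_combination (t - inner ℝ u μ) * hS2
    simp only [hP]
    constructor
    · simp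
    · intro t ht
      rcases mul_eq_zero.1 ht with ht | ht
      · linarith
      · rcases mul_eq_zero.1 ht with ht | ht <;> linarith

/-! ### Eigenspaces, flat portions and corners -/

open Matrix in
/-- Kernel vectors of the support pencil are determined by their first coordinate. -/
theorem eq_zero_of_supportPencil_mulVec_eq_zero {μ₁ μ₂ u : ℂ} (h₁ : ‖μ₁‖ < 1) (h₂ : ‖μ₂‖ < 1)
    (hu : ‖u‖ = 1) {t : ℝ} {x : Fin 3 → ℂ}
    (h : supportPencil (rankTwoPartialIsometry μ₁ μ₂) u t *ᵥ x = 0) (hx : x 0 = 0) : x = 0 := by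
  obtain ⟨h0, h1, h2⟩ := supportPencil_rankTwoPartialIsometry_mulVec_eq_zero h
  have e1 := ofReal_sqrt_one_sub_norm_sq_sq h₁
  have e2 := ofReal_sqrt_one_sub_norm_sq_sq h₂
  have n1 := ofReal_sqrt_one_sub_norm_sq_ne_zero h₁
  have n2 := ofReal_sqrt_one_sub_norm_sq_ne_zero h₂
  have eu := conj_mul_self_of_norm_eq_one hu
  have i1 := two_mul_ofReal_inner u μ₁
  have i2 := two_mul_ofReal_inner u μ₂
  rw [← i1] at h1
  rw [← i2] at h2
  rw [hx] at h0 h1 h2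
  set s := ((√(1 - ‖μ₁‖ ^ 2) : ℝ) : ℂ)
  set s' := ((√(1 - ‖μ₂‖ ^ 2) : ℝ) : ℂ)
  have h0' : s * x 1 = conj μ₁ * s' * x 2 := by
    linear_combination (-u) * h0 - (s * x 1 - conj μ₁ * s' * x 2) * eu
  by_cases hx2 : x 2 = 0
  · have hx1 : x 1 = 0 := by simpa [hx2, n1] using h0'
    ext i; fin_cases i <;> simp [hx, hx1, hx2]
  exfalso
  -- With `x 0 = 0` the first row ties `x 1` to `x 2`; eliminating `x 1` from the third and second
  -- rows leaves two scalar equations for `t`.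
  have A : 2 * (t : ℂ) - 2 * (inner ℝ u μ₂ : ℝ) = (u * conj μ₁) * s' ^ 2 := by
    apply mul_right_cancel₀ hx2
    linear_combination h2 + u * s' * h0'
  have B : (2 * (t : ℂ) - 2 * (inner ℝ u μ₁ : ℝ)) * (u * conj μ₁) = s ^ 2 := by
    apply mul_right_cancel₀ (mul_ne_zero n2 hx2)
    linear_combination u * s * h1 - (2 * (t : ℂ) - 2 * (inner ℝ u μ₁ : ℝ)) * u * h0' +
      s ^ 2 * s' * x 2 * eu
  have hre : (u * conj μ₁).re = inner ℝ u μ₁ := by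
    simp [mul_comm]
  have es' : s' ^ 2 = ((1 - ‖μ₂‖ ^ 2 : ℝ) : ℂ) := by rw [e2, Complex.mul_conj']; push_cast; ring
  have es : s ^ 2 = ((1 - ‖μ₁‖ ^ 2 : ℝ) : ℂ) := by rw [e1, Complex.mul_conj']; push_cast; ring
  have p1 := one_sub_norm_sq_pos h₁
  have p2 := one_sub_norm_sq_pos h₂
  rw [es'] at A
  rw [es] at B
  have Are := congrArg Complex.re A
  have Aim := congrArg Complex.im A
  have Bre := congrArg Complex.re B
  rw [Complex.re_mul_ofReal, hre] at Are
  rw [Complex.im_mul_ofReal] at Aim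
  simp only [← Complex.ofReal_ofNat, ← Complex.ofReal_mul, ← Complex.ofReal_sub,
    Complex.ofReal_re, Complex.ofReal_im, Complex.re_ofReal_mul, hre] at Are Aim Bre
  -- The left side of `A` is real, so `μ₁` is a real multiple of `u`, and `B` becomes `2tα = 1 +
  -- α²`.
  have him : (u * conj μ₁).im = 0 := by
    rcases mul_eq_zero.1 Aim.symm with h | h
    · exact h
    · exact absurd h p2.ne'
  have hm : ‖μ₁‖ ^ 2 = (inner ℝ u μ₁) ^ 2 := by
    have h3 := Complex.norm_sq_eq_re_im (u * conj μ₁)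
    rw [norm_mul, hu, one_mul, RCLike.norm_conj, hre, him] at h3
    linarith
  have hβ : |inner ℝ u μ₂| ≤ ‖μ₂‖ := by simpa [hu] using abs_real_inner_le_norm u μ₂
  have hα : |inner ℝ u μ₁| < 1 := by
    rw [← sq_eq_sq₀ (norm_nonneg _) (abs_nonneg _) |>.1 (hm.trans (sq_abs _).symm)]
    exact h₁
  rw [hm] at Bre
  generalize inner ℝ u μ₁ = α at *
  generalize inner ℝ u μ₂ = β at *
  generalize ‖μ₂‖ = k at *
  have hk : 0 ≤ k := (abs_nonneg _).trans hβ
  -- Equation `A` gives `|t| ≤ 1`, since `2k + 1 - k² ≤ 2`. Then `1 + α² ≤ 2|α|`, that is `(1 -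
  -- |α|)² ≤ 0`, contradicting `|α| < 1`.
  have ht : 2 * |t| ≤ 2 * k + |α| * (1 - k ^ 2) := by
    calc 2 * |t| = |2 * β + α * (1 - k ^ 2)| := by
          rw [show 2 * β + α * (1 - k ^ 2) = 2 * t by linarith, abs_mul]; simp
      _ ≤ |2 * β| + |α * (1 - k ^ 2)| := abs_add_le _ _
      _ ≤ _ := by
        rw [abs_mul, abs_mul, abs_of_pos p2, abs_two]; linarith
  have ht1 : |t| ≤ 1 := by nlinarith
  have ht2 : 1 + |α| ^ 2 ≤ 2 * (|t| * |α|) := by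
    rw [← abs_mul, sq_abs]
    have := le_abs_self (t * α)
    linarith
  nlinarith [abs_nonneg α, abs_nonneg t, mul_nonneg (abs_nonneg α) (sub_nonneg.2 ht1)]

/-- The point is uniformity: one vector representing `p` is killed by the pencils of all supporting
lines through `p` at once. -/
theorem exists_unit_kernel_vector {μ₁ μ₂ p : ℂ}
    (hp : p ∈ numericalRange (rankTwoPartialIsometry μ₁ μ₂)) :
    ∃ x : Fin 3 → ℂ, x ≠ 0 ∧ p = dotProduct (star x) ((rankTwoPartialIsometry μ₁ μ₂).mulVec x) ∧
      dotProduct (star x) x = 1 ∧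
      ∀ u : ℂ, (∀ z ∈ numericalRange (rankTwoPartialIsometry μ₁ μ₂), inner ℝ u z ≤ inner ℝ u p) →
        (supportPencil (rankTwoPartialIsometry μ₁ μ₂) u (inner ℝ u p)).mulVec x = 0 := by
  obtain ⟨x, hx, rfl⟩ := mem_numericalRange_iff.1 hp
  exact ⟨x, ne_zero_of_star_dotProduct_self hx, rfl, hx,
    fun u h => supportPencil_mulVec_eq_zero h hx rfl⟩

/-- A supporting line at the midpoint of a segment contains both endpoints. Unit vectors
representing them lie in the same one-dimensional kernel, hence differ by a phase and give the same
point. -/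
theorem not_hasFlatPortion_numericalRange {μ₁ μ₂ : ℂ} (h₁ : ‖μ₁‖ < 1) (h₂ : ‖μ₂‖ < 1) :
    ¬ HasFlatPortion (numericalRange (rankTwoPartialIsometry μ₁ μ₂)) := by
  set K := numericalRange (rankTwoPartialIsometry μ₁ μ₂) with hK
  have hcl : IsClosed K := (isCompact_numericalRange _).isClosed
  rintro ⟨p, q, hpq, hseg⟩
  have hp := hcl.frontier_subset (hseg (left_mem_segment ℝ p q))
  have hq := hcl.frontier_subset (hseg (right_mem_segment ℝ p q))
  obtain ⟨u, hu, hsup⟩ := exists_supporting_normal hcl (convex_numericalRange _)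
    (hseg (midpoint_mem_segment p q))
  have hmid : inner ℝ u (midpoint ℝ p q) = (inner ℝ u p + inner ℝ u q) / 2 := by
    rw [midpoint_eq_smul_add, real_inner_smul_right, inner_add_right]
    simp; ring
  rw [hmid] at hsup
  have hpq' : inner ℝ u p = inner ℝ u q := by
    linarith [hsup p hp, hsup q hq]
  obtain ⟨x, hx0, hpx, hx, hxk⟩ := exists_unit_kernel_vector hp
  obtain ⟨y, hy0, hqy, hy, hyk⟩ := exists_unit_kernel_vector hq
  have kx := hxk u fun z hz => (hsup z hz).trans_eq (by linarith)
  have ky := hyk u fun z hz => (hsup z hz).trans_eq (by linarith)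
  rw [← hpq'] at ky
  have hxx : x 0 ≠ 0 := fun h => hx0 (eq_zero_of_supportPencil_mulVec_eq_zero h₁ h₂ hu kx h)
  have hz := eq_zero_of_supportPencil_mulVec_eq_zero h₁ h₂ hu (x := y 0 • x - x 0 • y)
    (by rw [Matrix.mulVec_sub, Matrix.mulVec_smul, Matrix.mulVec_smul, kx, ky]; simp)
    (by simp [mul_comm])
  obtain ⟨k, rfl⟩ : ∃ k : ℂ, y = k • x := by
    refine ⟨(x 0)⁻¹ * y 0, ?_⟩
    rw [mul_smul, sub_eq_zero.1 hz, smul_smul, inv_mul_cancel₀ hxx, one_smul]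
  rw [star_smul, smul_dotProduct, dotProduct_smul, hx] at hy
  rw [star_smul, smul_dotProduct, Matrix.mulVec_smul, dotProduct_smul, ← hpx] at hqy
  simp only [smul_eq_mul, mul_one] at hy hqy
  rw [← mul_assoc, hy, one_mul] at hqy
  exact hpq hqy.symm

theorem zero_mem_numericalRange_rankTwoPartialIsometry (μ₁ μ₂ : ℂ) :
    (0 : ℂ) ∈ numericalRange (rankTwoPartialIsometry μ₁ μ₂) := by
  refine mem_numericalRange_iff.2 ⟨Pi.single 0 1, ?_, ?_⟩
  · simp
  · simp [rankTwoPartialIsometry, dotProduct, Fin.sum_univ_three]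

theorem zero_mem_interior_numericalRange {μ₁ μ₂ : ℂ} (h₁ : ‖μ₁‖ < 1) :
    (0 : ℂ) ∈ interior (numericalRange (rankTwoPartialIsometry μ₁ μ₂)) := by
  by_contra hint
  have hcl := (isCompact_numericalRange (rankTwoPartialIsometry μ₁ μ₂)).isClosed
  have hfr : (0 : ℂ) ∈ frontier (numericalRange (rankTwoPartialIsometry μ₁ μ₂)) := by
    rw [hcl.frontier_eq]
    exact ⟨zero_mem_numericalRange_rankTwoPartialIsometry μ₁ μ₂, hint⟩
  obtain ⟨u, hu, hsup⟩ := exists_supporting_normal hcl (convex_numericalRange _) hfr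
  have hk := supportPencil_mulVec_eq_zero hsup (x := Pi.single 0 1) (by simp)
    (by simp [rankTwoPartialIsometry, dotProduct, Fin.sum_univ_three])
  obtain ⟨-, h1, -⟩ := supportPencil_rankTwoPartialIsometry_mulVec_eq_zero hk
  have n1 := ofReal_sqrt_one_sub_norm_sq_ne_zero h₁
  have hu0 : u ≠ 0 := by rintro rfl; simp at hu
  rw [Pi.single_eq_same, Pi.single_eq_of_ne (by decide), Pi.single_eq_of_ne (by decide)] at h1
  -- If `0` were a boundary point, the first basis vector would be in the kernel of the pencil at `t
  -- = 0`; its second row reads `u √(1 - ‖μ₁‖²) = 0`.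
  exact mul_ne_zero hu0 n1 (by linear_combination -h1)

theorem hasSmoothBoundary_numericalRange {μ₁ μ₂ : ℂ} (h₁ : ‖μ₁‖ < 1) (h₂ : ‖μ₂‖ < 1) :
    HasSmoothBoundary (numericalRange (rankTwoPartialIsometry μ₁ μ₂)) := by
  set K := numericalRange (rankTwoPartialIsometry μ₁ μ₂) with hK
  have hcl : IsClosed K := (isCompact_numericalRange _).isClosed
  intro p hp
  obtain ⟨u, hu, hsup⟩ := exists_supporting_normal hcl (convex_numericalRange _) hp
  refine ⟨u, ⟨hu, hsup⟩, ?_⟩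
  rintro v ⟨hv, hvsup⟩
  by_contra hne
  by_cases hneg : v = -u
  -- Opposite normals confine `W(A)` to a line, so the second basis vector is in the kernel,
  -- although its first coordinate is zero.
  · subst hneg
    have hmem := mem_numericalRange_iff (A := rankTwoPartialIsometry μ₁ μ₂).2
      ⟨Pi.single 1 1, by simp, rfl⟩
    have hle := hvsup _ hmem
    simp only [inner_neg_left, neg_le_neg_iff] at hle
    have hk := supportPencil_mulVec_eq_zero hsup (x := Pi.single 1 1) (by simp)
      (le_antisymm (hsup _ hmem) hle)
    have := congrFun (eq_zero_of_supportPencil_mulVec_eq_zero h₁ h₂ hu hk (by simp)) 1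
    simp at this
  obtain ⟨x, hx0, hpx, hx, hxk⟩ := exists_unit_kernel_vector (hcl.frontier_subset hp)
  have ku := hxk u hsup
  have kv := hxk v hvsup
  have hxx : x 0 ≠ 0 := fun h => hx0 (eq_zero_of_supportPencil_mulVec_eq_zero h₁ h₂ hu ku h)
  have eu := conj_mul_self_of_norm_eq_one hu
  have ev := conj_mul_self_of_norm_eq_one hv
  -- `u` and `v` are linearly independent over the reals, so two equations in `A x` and `Aᴴ x` with
  -- these coefficients can be solved separately.
  have hD : u * conj v - conj u * v ≠ 0 := by
    intro h
    have : (v - u) * (v + u) = 0 := by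
      linear_combination -u * v * h - v ^ 2 * eu + u ^ 2 * ev
    rcases mul_eq_zero.1 this with h | h
    · exact hne (sub_eq_zero.1 h)
    · exact hneg (eq_neg_of_add_eq_zero_left h)
  obtain ⟨a0, a1, -⟩ := supportPencil_rankTwoPartialIsometry_mulVec_eq_zero ku
  obtain ⟨b0, b1, -⟩ := supportPencil_rankTwoPartialIsometry_mulVec_eq_zero kv
  generalize inner ℝ u p = a at *
  generalize inner ℝ v p = b at *
  have e1 := ofReal_sqrt_one_sub_norm_sq_sq h₁
  have n1 := ofReal_sqrt_one_sub_norm_sq_ne_zero h₁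
  have n2 := ofReal_sqrt_one_sub_norm_sq_ne_zero h₂
  set s := ((√(1 - ‖μ₁‖ ^ 2) : ℝ) : ℂ)
  set s' := ((√(1 - ‖μ₂‖ ^ 2) : ℝ) : ℂ)
  -- The bracket in the first row does not depend on the direction once the factors `conj u`, `conj
  -- v` are removed. Comparing rows, and conjugating, forces both support values to be zero.
  have hab : (a : ℂ) * conj v = b * conj u := by
    apply mul_right_cancel₀ hxx
    linear_combination conj v / 2 * a0 - conj u / 2 * b0
  have hab' : (a : ℂ) * v = b * u := by simpa using congrArg conj hab
  have ha : (a : ℂ) = 0 := by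
    have : (a : ℂ) * (u * conj v - conj u * v) = 0 := by
      linear_combination u * hab - conj u * hab'
    simpa [hD] using this
  have hb : (b : ℂ) = 0 := by
    have : (b : ℂ) * (u * conj v - conj u * v) = 0 := by
      linear_combination v * hab - conj v * hab'
    simpa [hD] using this
  rw [ha] at a0 a1
  rw [hb] at b1
  -- At support value zero the equations separate into rows of `A x = 0` and `Aᴴ x = 0`, which kill
  -- `x 2`, `x 1` and then `x 0`.
  have f0 : s * x 1 = conj μ₁ * s' * x 2 := by
    linear_combination (-u) * a0 - (s * x 1 - conj μ₁ * s' * x 2) * eu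
  have f1 : μ₁ * x 1 + s * s' * x 2 = 0 := by
    apply mul_left_cancel₀ hD
    linear_combination v * a1 - u * b1
  have g1 : s * x 0 + conj μ₁ * x 1 = 0 := by
    apply mul_left_cancel₀ hD
    linear_combination conj u * b1 - conj v * a1
  have hx2 : x 2 = 0 := by
    have : s' * x 2 = 0 := by
      linear_combination s * f1 - μ₁ * f0 - s' * x 2 * e1
    simpa [n2] using this
  have hx1 : x 1 = 0 := by simpa [hx2, n1] using f0
  rw [hx1] at g1
  exact mul_ne_zero n1 hxx (by linear_combination g1)

/-! ### Exclusion of ellipses -/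

/-- If a product of three linear forms agrees with a linear form on the unit circle, then the
product of the representing complex numbers vanishes. -/
theorem mul_mul_eq_zero_of_inner_mul_inner_mul_inner_eq {A B C V : ℂ}
    (h : ∀ u : ℂ, ‖u‖ = 1 → inner ℝ u A * inner ℝ u B * inner ℝ u C = inner ℝ u V) :
    A * B * C = 0 := by
  have hn (x y : ℝ) (hxy : x ^ 2 + y ^ 2 = 1) : ‖(⟨x, y⟩ : ℂ)‖ = 1 := by
    have := Complex.norm_sq_eq_re_im ⟨x, y⟩
    rw [hxy] at this
    nlinarith [norm_nonneg (⟨x, y⟩ : ℂ)]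
  -- The third harmonic of the left side is governed by `A * B * C`, while the right side has none;
  -- these four directions suffice to isolate its real and imaginary parts.
  have h1 := h ⟨1, 0⟩ (hn _ _ (by norm_num))
  have h2 := h ⟨0, 1⟩ (hn _ _ (by norm_num))
  have h3 := h ⟨3 / 5, 4 / 5⟩ (hn _ _ (by norm_num))
  have h4 := h ⟨3 / 5, -(4 / 5)⟩ (hn _ _ (by norm_num))
  simp only [Complex.real_inner_eq] at h1 h2 h3 h4
  apply Complex.ext <;> simp only [Complex.mul_re, Complex.mul_im, Complex.zero_re, Complex.zero_im]
  · linear_combination (25 / 16) * h1 - (125 / 96) * (h3 + h4)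
  · linear_combination (125 / 72) * (h3 - h4) - (25 / 9) * h2

theorem eq_zero_of_forall_unit_inner_eq_zero {V : ℂ}
    (h : ∀ u : ℂ, ‖u‖ = 1 → inner ℝ u V = 0) : V = 0 := by
  have h1 := h 1 (by simp)
  have h2 := h Complex.I (by simp)
  simp only [Complex.real_inner_eq] at h1 h2
  apply Complex.ext
  · simpa using h1
  · simpa using h2

theorem supportCubic_neg (μ₁ μ₂ u : ℂ) (t : ℝ) :
    supportCubic μ₁ μ₂ (-u) (-t) = -supportCubic μ₁ μ₂ u t := by
  simp only [supportCubic, inner_neg_left]; ring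

/-- If the support values of an ellipse are roots of the support cubics, then the third root
is a linear form in the direction. -/
theorem supportCubic_third_root {μ₁ μ₂ u c d : ℂ} {b : ℝ} (hb : 0 < b) (hu : ‖u‖ = 1)
    (h : ∀ u : ℂ, ‖u‖ = 1 → supportCubic μ₁ μ₂ u (inner ℝ u c + √((inner ℝ u d) ^ 2 + b)) = 0) :
    supportCubic μ₁ μ₂ u (inner ℝ u (μ₁ + μ₂ - 2 • c)) = 0 := by
  have h1 := h u hu
  have h2 := h (-u) (by simpa using hu)
  have hS : 0 < √((inner ℝ u d) ^ 2 + b) := Real.sqrt_pos.2 (by positivity)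
  rw [inner_neg_left, inner_neg_left, neg_sq] at h2
  set S := √((inner ℝ u d) ^ 2 + b)
  -- The support value in direction `-u` is minus the conjugate root `γ - S` for `u`.
  rw [show -inner ℝ u c + S = -(inner ℝ u c - S) by ring, supportCubic_neg, neg_eq_zero] at h2
  have hl : inner ℝ u (μ₁ + μ₂ - 2 • c) = inner ℝ u μ₁ + inner ℝ u μ₂ - 2 * inner ℝ u c := by
    simp only [two_smul, inner_sub_right, inner_add_right]; ring
  rw [hl]
  simp only [supportCubic] at *
  generalize inner ℝ u μ₁ = α at *
  generalize inner ℝ u μ₂ = β at *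
  generalize inner ℝ u c = γ at *
  -- The divided difference of the cubic at its two roots `γ ± S`, which are distinct since `S > 0`.
  -- As the three roots sum to `α + β`, the third is `α + β - 2γ`.
  have hQ := mul_left_cancel₀ hS.ne' (b := (γ + S) ^ 2 + (γ + S) * (γ - S) + (γ - S) ^ 2
    - (α + β) * (2 * γ) + α * β - (2 - ‖μ₂‖ ^ 2 - ‖μ₁‖ ^ 2) / 4) (c := 0)
    (by linear_combination (h1 - h2) / 2)
  linear_combination h1 + (α + β - 2 * γ - (γ + S)) * hQ

theorem not_isEllipticalDisk_numericalRange {μ₁ μ₂ : ℂ} (h₁ : ‖μ₁‖ < 1) (h₂ : ‖μ₂‖ < 1)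
    (hneg : μ₁ ≠ -μ₂) (hne : μ₁ ≠ μ₂) (f₁ f₂ : ℂ) :
    ¬ IsEllipticalDisk (numericalRange (rankTwoPartialIsometry μ₁ μ₂)) f₁ f₂ := by
  rintro ⟨r, hr, hK⟩
  obtain ⟨c, d, a, rfl, rfl, rfl⟩ : ∃ c d : ℂ, ∃ a : ℝ, f₁ = c + d ∧ f₂ = c - d ∧ r = 2 * a :=
    ⟨(f₁ + f₂) / 2, (f₁ - f₂) / 2, r / 2, by ring, by ring, by ring⟩
  have ha : ‖d‖ < a := by
    rw [dist_eq_norm, show c + d - (c - d) = 2 * d by ring] at hr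
    simpa using hr
  have hb : 0 < a ^ 2 - ‖d‖ ^ 2 := by nlinarith [norm_nonneg d]
  have hroot (u : ℂ) (hu : ‖u‖ = 1) := supportCubic_third_root hb hu fun u hu =>
    (det_supportPencil_rankTwoPartialIsometry_eq_zero_iff h₁ h₂ hu _).1
      (det_supportPencil_eq_zero (hK ▸ isGreatest_inner_image_ellipticalDisk ha hu))
  set L := μ₁ + μ₂ - 2 • c
  have p1 := one_sub_norm_sq_pos h₁
  have p2 := one_sub_norm_sq_pos h₂
  have hfac (u : ℂ) (hu : ‖u‖ = 1) : inner ℝ u L * inner ℝ u (L - μ₁) * inner ℝ u (L - μ₂) =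
      inner ℝ u ((4⁻¹ : ℝ) • ((1 - ‖μ₂‖ ^ 2) • (L - μ₁) + (1 - ‖μ₁‖ ^ 2) • (L - μ₂))) := by
    have h := hroot u hu
    simp only [supportCubic] at h
    simp only [real_inner_smul_right, inner_add_right, inner_sub_right]
    linear_combination h
  have hprod := mul_mul_eq_zero_of_inner_mul_inner_mul_inner_eq hfac
  have hcases : L = 0 ∨ L - μ₁ = 0 ∨ L - μ₂ = 0 := by
    rcases mul_eq_zero.1 hprod with h | h
    · rcases mul_eq_zero.1 h with h | h <;> simp [h]
    · simp [h]
  -- One of the three forms is identically zero, so the linear form on the right vanishes in every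
  -- direction.
  have hV : (4⁻¹ : ℝ) • ((1 - ‖μ₂‖ ^ 2) • (L - μ₁) + (1 - ‖μ₁‖ ^ 2) • (L - μ₂)) = 0 := by
    refine eq_zero_of_forall_unit_inner_eq_zero fun u hu => ?_
    rw [← hfac u hu]
    rcases hcases with h | h | h <;> rw [h] <;> simp
  have hV' := (smul_eq_zero.1 hV).resolve_left (by norm_num)
  rcases hcases with h | h | h
  -- Here `(1 - ‖μ₂‖²) μ₁ = -(1 - ‖μ₁‖²) μ₂`. Taking norms gives equal moduli, hence `μ₁ = -μ₂`. The
  -- other two cases give `L = μ₁ = μ₂`.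
  · rw [h, zero_sub, zero_sub, smul_neg, smul_neg, ← neg_add, neg_eq_zero] at hV'
    have hn := congrArg norm (eq_neg_of_add_eq_zero_left hV')
    rw [norm_neg, norm_smul, norm_smul, Real.norm_of_nonneg p1.le, Real.norm_of_nonneg p2.le] at hn
    have hxy : ‖μ₁‖ = ‖μ₂‖ := by
      have h3 : (‖μ₁‖ - ‖μ₂‖) * (1 + ‖μ₁‖ * ‖μ₂‖) = 0 := by linear_combination hn
      have h4 : 1 + ‖μ₁‖ * ‖μ₂‖ ≠ 0 := by positivity
      exact sub_eq_zero.1 ((mul_eq_zero.1 h3).resolve_right h4)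
    rw [hxy, ← smul_add] at hV'
    exact hneg (eq_neg_of_add_eq_zero_left ((smul_eq_zero.1 hV').resolve_left p2.ne'))
  · rw [h, smul_zero, zero_add] at hV'
    have := (smul_eq_zero.1 hV').resolve_left p1.ne'
    exact hne ((sub_eq_zero.1 h).symm.trans (sub_eq_zero.1 this))
  · rw [h, smul_zero, add_zero] at hV'
    have := (smul_eq_zero.1 hV').resolve_left p2.ne'
    exact hne ((sub_eq_zero.1 this).symm.trans (sub_eq_zero.1 h))

theorem mainTheorem9 (μ₁ μ₂ : ℂ) (h₁ : ‖μ₁‖ < 1) (h₂ : ‖μ₂‖ < 1) :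
    (μ₁ = -μ₂ → IsEllipticalDisk (numericalRange (rankTwoPartialIsometry μ₁ μ₂)) μ₁ μ₂) ∧
    (μ₁ = μ₂ → IsEllipticalDisk (numericalRange (rankTwoPartialIsometry μ₁ μ₂)) 0 μ₁) ∧
    (μ₁ ≠ -μ₂ → μ₁ ≠ μ₂ → IsOvular (numericalRange (rankTwoPartialIsometry μ₁ μ₂))) := by
  refine ⟨?_, ?_, fun hneg hne => ?_⟩
  · rintro rfl
    exact isEllipticalDisk_numericalRange_neg h₂
  · rintro rfl
    exact isEllipticalDisk_numericalRange_self h₁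
  · exact
      { isCompact := isCompact_numericalRange _
        convex := convex_numericalRange _
        nonempty_interior := ⟨0, zero_mem_interior_numericalRange h₁⟩
        smooth := hasSmoothBoundary_numericalRange h₁ h₂
        not_flat := not_hasFlatPortion_numericalRange h₁ h₂
        not_elliptical := not_isEllipticalDisk_numericalRange h₁ h₂ hneg hne }
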